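/- Let $G=(V,E)$ be a finite simple graph. An intersection representation of $G$ is a family $(c(v))_{v\in V}$ of subsets ("shapes") of the Euclidean plane such that two distinct vertices $u,v$ are adjacent in $G$ if and only if $c(u)\cap c(v)\neq\emptyset$; it is called simple if every point of the plane belongs to at most two of the shapes. A graph is planar if it can be drawn in the plane with distinct points as vertices and simple arcs as edges so that an edge, apart from its two ends, meets no vertex and no other edge. (1) Suppose that $G$ has a simple intersection representation $(c(v))_{v\in V}$ such that every $c(v)$ is homeomorphic to a closed disk and, for every ordered pair $(u,v)$ of distinct vertices, the set $c(u)\setminus c(v)$ is non-empty and connected. Then $G$ is planar. (2) For any two triangles $T,T'$ in the plane that are homothetic (that is, both are images of one non-degenerate closed triangle under maps $x\mapsto hx+a$ with $h>0$), the set $T\setminus T'$ is connected (possibly empty). (3) Consequently, if $G$ has a simple intersection representation by pairwise homothetic (in the sense of (2)) non-degenerate triangles, then $G$ is planar. -/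

import Mathlib

/-- The Euclidean plane. -/
abbrev Plane : Type := EuclideanSpace ℝ (Fin 2)

/-- `S` is homeomorphic to a (closed) disk. -/
def IsDisk (S : Set Plane) : Prop :=
  Nonempty (S ≃ₜ Metric.closedBall (0 : Plane) 1)

/-- The family `c` of subsets of the plane is an intersection representation of `G`:
two distinct vertices are adjacent if and only if their shapes intersect. -/
def IsIntersectionRepresentation {V : Type*} (G : SimpleGraph V) (c : V → Set Plane) : Prop :=
  ∀ u v : V, G.Adj u v ↔ u ≠ v ∧ (c u ∩ c v).Nonempty

/-- A family of shapes is simple if every point of the plane belongs to at most two shapes. -/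
def IsSimpleFamily {V : Type*} (c : V → Set Plane) : Prop :=
  ∀ x : Plane, {v : V | x ∈ c v}.encard ≤ 2

/-- `A` is a simple arc in the plane with end points `x` and `y`. -/
def IsArcBetween (A : Set Plane) (x y : Plane) : Prop :=
  ∃ γ : Path x y, Function.Injective γ ∧ Set.range γ = A

/-- A drawing of `G` in the plane without crossings: the vertices are distinct points, every edge
is an arc between its ends, and an edge without its ends meets no vertex and no other edge. -/
structure IsPlaneDrawing {V : Type*} (G : SimpleGraph V) (p : V → Plane)
    (arc : Sym2 V → Set Plane) : Prop where
  injective : Function.Injective p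
  isArc : ∀ u v : V, G.Adj u v → IsArcBetween (arc s(u, v)) (p u) (p v)
  disjoint_vertices : ∀ e ∈ G.edgeSet, ∀ w : V, p w ∈ arc e → w ∈ e
  disjoint_edges : ∀ e ∈ G.edgeSet, ∀ f ∈ G.edgeSet, e ≠ f →
    Disjoint (arc e \ p '' {w : V | w ∈ e}) (arc f)

/-- A graph is planar if it can be drawn in the plane without crossings. -/
def IsPlanar {V : Type*} (G : SimpleGraph V) : Prop :=
  ∃ (p : V → Plane) (arc : Sym2 V → Set Plane), IsPlaneDrawing G p arc

/-- The full (closed) triangle spanned by three affinely independent points. -/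
def fullTriangle (Δ : Affine.Triangle ℝ Plane) : Set Plane :=
  convexHull ℝ (Set.range Δ.points)

/-- `T` is a homothet of `S`: the image of `S` under a scaling by a positive factor followed by
a translation. -/
def IsHomothet (S T : Set Plane) : Prop :=
  ∃ (h : ℝ) (a : Plane), 0 < h ∧ T = (fun x : Plane => h • x + a) '' S

/-! ### Tame discs and arcs in the plane -/

section Arcs

open Set Metric Topology unitInterval Pointwise

/-! The private part of a shape is what remains after all other shapes are removed. By simplicity,
the traces of the other shapes on `c v` are pairwise disjoint closed sets. A disk and a triangle are
simply connected, hence unicoherent: disjoint closed sets that do not separate individually do not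
separate together (`isPreconnected_compl_union`). So the private part of every shape is connected.
Each vertex becomes an open neighbourhood of its private part, and each edge a component of a thin
neighbourhood of the intersection of its two shapes. Points of such an intersection keep a positive
distance from every third shape, so these regions are disjoint except where a vertex and an edge are
incident. A shape contained in another one has empty private part and is represented by a small ball
inside it; this is needed only for triangles. `isPlanar_of_regions` turns such regions into a
drawing: vertices are centres of tame discs, and edges are arcs made radial inside the discs of
their ends. For homothetic triangles the connectedness of differences is read off from barycentric
coordinates. -/

/-- A homeomorphism of a Banach space supported in a ball and moving its center to any given
point of the ball. -/
theorem exists_homeomorph_move {E : Type*} [NormedAddCommGroup E] [NormedSpace ℝ E]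
    [CompleteSpace E] {x y : E} {ρ : ℝ} (h : dist x y < ρ) :
    ∃ φ : E ≃ₜ E, φ y = x ∧ ∀ z, z ∉ ball y ρ → φ z = z := by
  have hρ : 0 < ρ := dist_nonneg.trans_lt h
  -- The perturbation of the identity has Lipschitz constant `dist x y / ρ < 1`, so `f` is a
  -- homeomorphism; it vanishes outside the ball.
  let f : E → E := fun z => z + max 0 (1 - ‖z - y‖ / ρ) • (x - y)
  let c : NNReal := ⟨dist x y / ρ, by positivity⟩
  have hc : c < 1 := by
    rw [← NNReal.coe_lt_coe]
    exact (div_lt_one hρ).2 h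
  have hf : ApproximatesLinearOn f ((ContinuousLinearEquiv.refl ℝ E : E ≃L[ℝ] E) : E →L[ℝ] E)
      univ c := by
    intro z _ w _
    have e : f z - f w - ((ContinuousLinearEquiv.refl ℝ E : E ≃L[ℝ] E) : E →L[ℝ] E) (z - w)
        = (max 0 (1 - ‖z - y‖ / ρ) - max 0 (1 - ‖w - y‖ / ρ)) • (x - y) := by
      simp only [f, ContinuousLinearEquiv.coe_coe, ContinuousLinearEquiv.refl_apply, sub_smul]
      abel
    rw [e, norm_smul]
    have h1 : ‖max 0 (1 - ‖z - y‖ / ρ) - max 0 (1 - ‖w - y‖ / ρ)‖ ≤ ‖z - w‖ / ρ := by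
      rw [Real.norm_eq_abs]
      refine (abs_max_sub_max_le_max _ _ _ _).trans ?_
      rw [sub_self, abs_zero, max_eq_right (abs_nonneg _)]
      have : 1 - ‖z - y‖ / ρ - (1 - ‖w - y‖ / ρ) = (‖w - y‖ - ‖z - y‖) / ρ := by ring
      rw [this, abs_div, abs_of_pos hρ]
      gcongr
      refine (abs_norm_sub_norm_le _ _).trans ?_
      rw [sub_sub_sub_cancel_right, norm_sub_rev]
    calc _ ≤ ‖z - w‖ / ρ * ‖x - y‖ := by gcongr
      _ = c * ‖z - w‖ := by
        change _ = dist x y / ρ * _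
        rw [dist_eq_norm]; ring
  have hN : Subsingleton E ∨ c < ‖((ContinuousLinearEquiv.refl ℝ E).symm : E →L[ℝ] E)‖₊⁻¹ := by
    rcases subsingleton_or_nontrivial E with hs | hn
    · exact Or.inl hs
    · right
      have : ‖((ContinuousLinearEquiv.refl ℝ E).symm : E →L[ℝ] E)‖₊ = 1 := by
        simp [ContinuousLinearEquiv.refl_symm, ContinuousLinearMap.nnnorm_id]
      rw [this, inv_one]; exact hc
  refine ⟨hf.toHomeomorph f hN, ?_, ?_⟩
  · change f y = x
    simp [f]
  · intro z hz
    change f z = z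
    have : 1 - ‖z - y‖ / ρ ≤ 0 := by
      rw [mem_ball, dist_eq_norm, not_lt] at hz
      rw [sub_nonpos, one_le_div hρ]
      exact hz
    simp [f, max_eq_left this]

theorem exists_homeomorph_image_ball {E : Type*} [NormedAddCommGroup E] [NormedSpace ℝ E]
    (x : E) {r : ℝ} (hr : 0 < r) :
    ∃ φ : E ≃ₜ E, φ 0 = x ∧ φ '' closedBall 0 1 = closedBall x r := by
  refine ⟨(Homeomorph.smulOfNeZero r hr.ne').trans (Homeomorph.addLeft x), by simp, ?_⟩
  have : (((Homeomorph.smulOfNeZero r hr.ne').trans (Homeomorph.addLeft x) : E ≃ₜ E) : E → E)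
      = (fun z => x + z) ∘ (fun z => r • z) := rfl
  rw [this, image_comp]
  have h2 : (fun z : E => r • z) '' closedBall 0 1 = r • closedBall (0 : E) 1 := rfl
  rw [h2, smul_unitClosedBall_of_nonneg hr.le]
  simp

/-- A finite subset of a connected open set lies in the interior of a tame disc contained in
this set. -/
theorem exists_homeomorph_ball_superset {E : Type*} [NormedAddCommGroup E] [NormedSpace ℝ E]
    [CompleteSpace E] {O : Set E} (hO : IsOpen O) (hc : IsConnected O) {F : Set E}
    (hF : F.Finite) (hFO : F ⊆ O) :
    ∃ φ : E ≃ₜ E, φ '' closedBall 0 1 ⊆ O ∧ F ⊆ φ '' ball 0 1 := by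
  induction F, hF using Set.Finite.induction_on with
  | empty =>
    obtain ⟨x, hx⟩ := hc.nonempty
    obtain ⟨r, hr, hrO⟩ := nhds_basis_closedBall.mem_iff.1 (hO.mem_nhds hx)
    obtain ⟨φ, -, hφ⟩ := exists_homeomorph_image_ball x hr
    exact ⟨φ, hφ ▸ hrO, empty_subset _⟩
  | @insert a F haF hF ih =>
    obtain ⟨φ₀, hφ₀, hφF₀⟩ := ih ((subset_insert _ _).trans hFO)
    -- The points that can be swallowed together with `F` form an open set which is relatively
    -- closed in `O`: a limit point `x ∉ F` is reached by pushing a nearby point `y` to `x` inside a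
    -- ball that lies in `O` and avoids `F`.
    let S : Set E := {x | ∃ φ : E ≃ₜ E, φ '' closedBall 0 1 ⊆ O ∧ insert x F ⊆ φ '' ball 0 1}
    suffices h : O ⊆ S from h (hFO (mem_insert _ _))
    have hS : IsOpen S := by
      rw [isOpen_iff_mem_nhds]
      rintro x ⟨φ, h1, h2⟩
      have : φ '' ball 0 1 ∈ 𝓝 x :=
        ((φ.isOpenMap _ isOpen_ball)).mem_nhds (h2 (mem_insert _ _))
      filter_upwards [this] with y hy
      exact ⟨φ, h1, insert_subset hy ((subset_insert _ _).trans h2)⟩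
    refine hc.isPreconnected.subset_of_closure_inter_subset hS ?_ ?_
    · have h0 : φ₀ 0 ∈ φ₀ '' ball 0 1 := mem_image_of_mem _ (by simp)
      exact ⟨φ₀ 0, hφ₀ (image_mono ball_subset_closedBall h0), φ₀, hφ₀, insert_subset h0 hφF₀⟩
    · rintro x ⟨hxS, hxO⟩
      by_cases hxF : x ∈ F
      · exact ⟨φ₀, hφ₀, insert_subset (hφF₀ hxF) hφF₀⟩
      have hopen : IsOpen (O \ F) := hO.sdiff hF.isClosed
      obtain ⟨r, hr, hrO⟩ := Metric.isOpen_iff.1 hopen x ⟨hxO, hxF⟩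
      obtain ⟨y, ⟨φ, h1, h2⟩, hxy⟩ := Metric.mem_closure_iff.1 hxS (r / 2) (by positivity)
      obtain ⟨ψ, hψ, hψ'⟩ := exists_homeomorph_move hxy
      have hball : ball y (r / 2) ⊆ O \ F := by
        refine (ball_subset_ball' ?_).trans hrO
        rw [dist_comm]; linarith
      refine ⟨φ.trans ψ, ?_, insert_subset ?_ ?_⟩
      · rintro _ ⟨z, hz, rfl⟩
        have hzO : φ z ∈ O := h1 (mem_image_of_mem _ hz)
        change ψ (φ z) ∈ O
        by_cases hb : φ z ∈ ball y (r / 2)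
        · by_contra hn
          have h3 := hψ' (ψ (φ z)) fun hh => hn (hball hh).1
          rw [ψ.injective h3] at hn
          exact hn hzO
        · rwa [hψ' _ hb]
      · obtain ⟨z, hz, hzy⟩ := h2 (mem_insert _ _)
        exact ⟨z, hz, by rw [Homeomorph.trans_apply, hzy, hψ]⟩
      · intro w hw
        obtain ⟨z, hz, hzy⟩ := h2 (mem_insert_of_mem _ hw)
        refine ⟨z, hz, ?_⟩
        rw [Homeomorph.trans_apply, hzy, hψ' _ fun hh => (hball hh).2 hw]

theorem IsArcBetween.symm {A : Set Plane} {x y : Plane} (h : IsArcBetween A x y) :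
    IsArcBetween A y x := by
  obtain ⟨γ, hγ, rfl⟩ := h
  exact ⟨γ.symm, hγ.comp unitInterval.symm_bijective.injective, by simp⟩

theorem IsArcBetween.image {A : Set Plane} {x y : Plane} (h : IsArcBetween A x y)
    (φ : Plane ≃ₜ Plane) : IsArcBetween (φ '' A) (φ x) (φ y) := by
  obtain ⟨γ, hγ, rfl⟩ := h
  refine ⟨γ.map φ.continuous, ?_, ?_⟩
  · rw [Path.map_coe]; exact φ.injective.comp hγ
  · rw [Path.map_coe, range_comp]

theorem isArcBetween_segment {x y : Plane} (h : x ≠ y) : IsArcBetween (segment ℝ x y) x y :=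
  ⟨Path.segment x y, Path.segment_injective_of_ne h, Path.range_segment x y⟩

theorem IsArcBetween.trans {A B : Set Plane} {x y z : Plane} (hA : IsArcBetween A x y)
    (hB : IsArcBetween B y z) (hAB : A ∩ B ⊆ {y}) : IsArcBetween (A ∪ B) x z := by
  obtain ⟨γ, hγ, rfl⟩ := hA
  obtain ⟨δ, hδ, rfl⟩ := hB
  refine ⟨γ.trans δ, ?_, Path.trans_range γ δ⟩
  have key : ∀ s t : I, γ s = δ t → s = 1 ∧ t = 0 := by
    intro s t hst
    have h1 : γ s = y := hAB ⟨mem_range_self s, hst ▸ mem_range_self t⟩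
    exact ⟨hγ (h1.trans γ.target.symm), hδ ((hst.symm.trans h1).trans δ.source.symm)⟩
  intro s t hst
  rw [Path.trans_apply, Path.trans_apply] at hst
  split_ifs at hst with h1 h2 h2
  · have := congrArg Subtype.val (hγ hst)
    simp only at this
    exact Subtype.ext (by linarith)
  · have := congrArg Subtype.val (key _ _ hst).2
    simp only [Icc.coe_zero] at this
    exact absurd (by linarith : (t : ℝ) ≤ 1 / 2) h2
  · have := congrArg Subtype.val (key _ _ hst.symm).2
    simp only [Icc.coe_zero] at this
    exact absurd (by linarith : (s : ℝ) ≤ 1 / 2) h1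
  · have := congrArg Subtype.val (hδ hst)
    simp only at this
    exact Subtype.ext (by linarith)

theorem isArcBetween_image_Icc (γ : C(I, Plane)) (hγ : Function.Injective γ) {t : I} (ht : t < 1) :
    IsArcBetween (γ '' Icc t 1) (γ t) (γ 1) := by
  let δ : Path (γ 0) (γ 1) := ⟨γ, rfl, rfl⟩
  refine ⟨δ.subpath t 1, ?_, Path.range_subpath_of_le δ t 1 ht.le⟩
  refine Function.Injective.comp (g := γ) hγ ?_
  intro a b hab
  have h := congrArg Subtype.val hab
  rw [Icc.coe_convexComb, Icc.coe_convexComb] at h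
  have ht' : (t : ℝ) < 1 := ht
  simp only [Icc.coe_one] at h
  have h3 : ((a : ℝ) - b) * (1 - t) = 0 := by linarith
  rcases mul_eq_zero.1 h3 with h4 | h4
  · exact Subtype.ext (by linarith)
  · linarith

/-- Two points of a connected open subset of the plane are joined by an arc in this set. -/
theorem exists_isArcBetween_subset {K : Set Plane} (hK : IsOpen K) (hc : IsConnected K)
    {x y : Plane} (hx : x ∈ K) (hy : y ∈ K) (hxy : x ≠ y) :
    ∃ A ⊆ K, IsArcBetween A x y := by
  obtain ⟨φ, h1, h2⟩ := exists_homeomorph_ball_superset hK hc (Set.toFinite {x, y})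
    (by simp [insert_subset_iff, hx, hy])
  obtain ⟨a, ha, rfl⟩ := h2 (mem_insert x _)
  obtain ⟨b, hb, rfl⟩ := h2 (mem_insert_of_mem _ (mem_singleton y))
  refine ⟨φ '' segment ℝ a b, (image_mono ?_).trans h1,
    (isArcBetween_segment fun h => hxy (congrArg φ h)).image φ⟩
  exact ((convex_ball 0 1).segment_subset ha hb).trans ball_subset_closedBall

/-- An arc starting in a tame disc and leaving it can be replaced by a radius of the disc
followed by a part of the arc outside of the disc. -/
theorem IsArcBetween.exists_radial {A : Set Plane} {x y : Plane} (h : IsArcBetween A x y)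
    (φ : Plane ≃ₜ Plane) (hx : x ∈ φ '' closedBall 0 1) (hy : y ∉ φ '' closedBall 0 1) :
    ∃ s ∈ sphere (0 : Plane) 1, φ s ∈ A ∧ ∃ B, IsArcBetween B (φ 0) y ∧
      B ⊆ φ '' segment ℝ 0 s ∪ A ∧ B ∩ φ '' closedBall 0 1 ⊆ φ '' segment ℝ 0 s := by
  obtain ⟨γ, hγ, rfl⟩ := h
  let g : I → ℝ := fun t => ‖φ.symm (γ t)‖
  have hg : Continuous g := (φ.symm.continuous.comp γ.continuous).norm
  have hgC : ∀ t, γ t ∈ φ '' closedBall 0 1 ↔ g t ≤ 1 := by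
    intro t
    constructor
    · rintro ⟨z, hz, hzt⟩
      simpa [g, ← hzt] using hz
    · intro ht
      exact ⟨φ.symm (γ t), by simpa using ht, by simp⟩
  have h0 : g 0 ≤ 1 := (hgC 0).1 (by simpa using hx)
  have h1 : 1 < g 1 := by
    by_contra hn
    exact hy (by simpa using (hgC 1).2 (not_lt.1 hn))
  -- The last parameter at which the arc is in the disc; the part before it is replaced by a radius.
  obtain ⟨t, ht, hmax⟩ := (isClosed_le hg continuous_const : IsClosed {t | g t ≤ 1}).isCompact
    |>.exists_isGreatest ⟨0, h0⟩
  have hlt : ∀ s, t < s → 1 < g s := fun s hs => by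
    by_contra hn
    exact absurd (hmax (not_lt.1 hn : g s ≤ 1)) (not_le.2 hs)
  have ht1 : t < 1 := by
    refine lt_of_le_of_ne le_one' ?_
    rintro rfl
    exact absurd ht (not_le.2 h1)
  have hgt : g t = 1 := by
    refine le_antisymm ht ?_
    by_contra hn
    have : ∀ᶠ s in 𝓝 t, g s < 1 := hg.continuousAt.eventually_lt continuousAt_const (not_le.1 hn)
    have hne : (𝓝[>] t).NeBot := nhdsGT_neBot_of_exists_gt ⟨1, ht1⟩
    obtain ⟨s, hs, hts⟩ := ((this.filter_mono nhdsWithin_le_nhds).and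
      (self_mem_nhdsWithin : Ioi t ∈ 𝓝[>] t)).exists
    exact absurd (hlt s hts) (not_lt.2 (le_of_lt hs))
  set s : Plane := φ.symm (γ t) with hs
  have hφs : φ s = γ t := by simp [hs]
  have hs1 : s ∈ sphere (0 : Plane) 1 := by simpa using hgt
  have hs0 : (0 : Plane) ≠ s := by
    rintro h
    rw [← h] at hs1
    simp at hs1
  have hseg : segment ℝ 0 s ⊆ closedBall (0 : Plane) 1 :=
    (convex_closedBall 0 1).segment_subset (by simp) (sphere_subset_closedBall hs1)
  have hC : γ '' Icc t 1 ∩ φ '' closedBall 0 1 ⊆ {φ s} := by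
    rintro _ ⟨⟨r, hr, rfl⟩, hrC⟩
    rcases hr.1.eq_or_lt with h | h
    · rw [mem_singleton_iff, hφs, h]
    · exact absurd ((hgC r).1 hrC) (not_le.2 (hlt r h))
  have harc : IsArcBetween (γ '' Icc t 1) (φ s) y := by
    have := isArcBetween_image_Icc γ.toContinuousMap hγ ht1
    rw [hφs]
    simpa using this
  refine ⟨s, hs1, hφs ▸ mem_range_self t, φ '' segment ℝ 0 s ∪ γ '' Icc t 1,
    ((isArcBetween_segment hs0).image φ).trans harc ?_, ?_, ?_⟩
  · rintro z ⟨hz1, hz2⟩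
    exact hC ⟨hz2, image_mono hseg hz1⟩
  · exact union_subset_union_right _ (image_subset_range _ _)
  · rintro z ⟨hz | hz, hzC⟩
    · exact hz
    · rw [hC ⟨hz, hzC⟩]
      exact mem_image_of_mem _ (right_mem_segment ℝ 0 s)

end Arcs
-- From disjoint regions to a drawing
section Regions

open Set Metric Topology

/-- A graph is planar if its vertices can be represented by disjoint plane regions, and its edges
by disjoint plane regions, such that the region of an edge meets the region of a vertex if and only
if the vertex is an end of the edge. -/
theorem isPlanar_of_regions {V : Type*} [Finite V] {G : SimpleGraph V} {O : V → Set Plane}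
    {K : Sym2 V → Set Plane} (hO : ∀ v, IsOpen (O v)) (hOc : ∀ v, IsConnected (O v))
    (hOd : ∀ u v, u ≠ v → Disjoint (O u) (O v))
    (hK : ∀ e ∈ G.edgeSet, IsOpen (K e)) (hKc : ∀ e ∈ G.edgeSet, IsConnected (K e))
    (hKd : ∀ e ∈ G.edgeSet, ∀ f ∈ G.edgeSet, e ≠ f → Disjoint (K e) (K f))
    (hKO : ∀ e ∈ G.edgeSet, ∀ v ∈ e, (K e ∩ O v).Nonempty)
    (hKO' : ∀ e ∈ G.edgeSet, ∀ v, v ∉ e → Disjoint (K e) (O v)) : IsPlanar G := by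
  have hdisc : ∀ v, ∃ φ : Plane ≃ₜ Plane, φ '' closedBall 0 1 ⊆ O v ∧
      ∀ e ∈ G.edgeSet, v ∈ e → (K e ∩ φ '' closedBall 0 1).Nonempty := by
    intro v
    -- Pairs that are not edges at `v` get an arbitrary point of `O v`, so that the finite range of
    -- `x` can be enclosed in one disc.
    have hx : ∀ e : Sym2 V, ∃ x ∈ O v, e ∈ G.edgeSet → v ∈ e → x ∈ K e := by
      intro e
      by_cases h : e ∈ G.edgeSet ∧ v ∈ e
      · obtain ⟨x, hx1, hx2⟩ := hKO e h.1 v h.2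
        exact ⟨x, hx2, fun _ _ => hx1⟩
      · obtain ⟨x, hx⟩ := (hOc v).nonempty
        exact ⟨x, hx, fun h1 h2 => absurd ⟨h1, h2⟩ h⟩
    choose x hxO hxK using hx
    obtain ⟨φ, h1, h2⟩ := exists_homeomorph_ball_superset (hO v) (hOc v) (finite_range x)
      (range_subset_iff.2 hxO)
    exact ⟨φ, h1, fun e he hv => ⟨x e, hxK e he hv,
      image_mono ball_subset_closedBall (h2 (mem_range_self e))⟩⟩
  choose φ hφO hφK using hdisc
  have hCd : ∀ {u v z}, z ∈ φ u '' closedBall 0 1 → z ∈ φ v '' closedBall 0 1 → u = v := by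
    intro u v z hu hv
    by_contra h
    exact disjoint_left.1 (hOd u v h) (hφO u hu) (hφO v hv)
  have h0C : ∀ v, φ v 0 ∈ φ v '' closedBall 0 1 := fun v => mem_image_of_mem _ (by simp)
  have hseg : ∀ v, ∀ s ∈ sphere (0 : Plane) 1, φ v '' segment ℝ 0 s ⊆ φ v '' closedBall 0 1 :=
    fun v s hs => image_mono
      ((convex_closedBall 0 1).segment_subset (by simp) (sphere_subset_closedBall hs))
  have harc : ∀ e : Sym2 V, ∃ A : Set Plane, e ∈ G.edgeSet →
      (∀ u v, e = s(u, v) → IsArcBetween A (φ u 0) (φ v 0)) ∧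
      (∀ z ∈ A, z ∈ K e ∨ ∃ v ∈ e, z ∈ φ v '' closedBall 0 1) ∧
      (∀ v ∈ e, ∃ s ∈ sphere (0 : Plane) 1, φ v s ∈ K e ∧
        A ∩ φ v '' closedBall 0 1 ⊆ φ v '' segment ℝ 0 s) := by
    intro e
    by_cases he : e ∈ G.edgeSet
    swap
    · exact ⟨∅, fun h => absurd h he⟩
    induction e using Sym2.ind with
    | _ u v =>
    have huv : u ≠ v := G.ne_of_adj he
    obtain ⟨x, hxK, hxC⟩ := hφK u _ he (Sym2.mem_mk_left u v)
    obtain ⟨y, hyK, hyC⟩ := hφK v _ he (Sym2.mem_mk_right u v)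
    have hyC' : y ∉ φ u '' closedBall 0 1 := fun h => huv (hCd h hyC)
    obtain ⟨A, hAK, hA⟩ := exists_isArcBetween_subset (hK _ he) (hKc _ he) hxK hyK
      (fun h => hyC' (h ▸ hxC))
    obtain ⟨s, hs, hsA, B, hB, hBA, hBC⟩ := hA.exists_radial (φ u) hxC hyC'
    obtain ⟨t, ht, htB, D, hD, hDB, hDC⟩ := hB.symm.exists_radial (φ v) hyC
      (fun h => huv (hCd (h0C u) h))
    have htC : φ v t ∈ φ v '' closedBall 0 1 := mem_image_of_mem _ (sphere_subset_closedBall ht)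
    have htK : φ v t ∈ K s(u, v) := by
      rcases hBA htB with h | h
      · exact absurd (hCd (hseg u s hs h) htC) huv
      · exact hAK h
    refine ⟨D, fun _ => ⟨?_, ?_, ?_⟩⟩
    · intro a b hab
      rcases Sym2.eq_iff.1 hab with ⟨rfl, rfl⟩ | ⟨rfl, rfl⟩
      · exact hD.symm
      · exact hD
    · intro z hz
      rcases hDB hz with h | h
      · exact Or.inr ⟨v, Sym2.mem_mk_right u v, hseg v t ht h⟩
      · rcases hBA h with h | h
        · exact Or.inr ⟨u, Sym2.mem_mk_left u v, hseg u s hs h⟩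
        · exact Or.inl (hAK h)
    · intro w hw
      rcases Sym2.mem_iff.1 hw with rfl | rfl
      · refine ⟨s, hs, hAK hsA, ?_⟩
        rintro z ⟨hzD, hzC⟩
        rcases hDB hzD with h | h
        · exact absurd (hCd hzC (hseg v t ht h)) huv
        · exact hBC ⟨h, hzC⟩
      · exact ⟨t, ht, htK, hDC⟩
  choose arc harc using harc
  have hmem : ∀ e ∈ G.edgeSet, ∀ w, ∀ z ∈ arc e, z ∈ φ w '' closedBall 0 1 → w ∈ e := by
    intro e he w z hz hzw
    by_contra hw
    rcases (harc e he).2.1 z hz with h | ⟨v, hv, h⟩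
    · exact disjoint_left.1 (hKO' e he w hw) h (hφO w hzw)
    · exact hw (hCd hzw h ▸ hv)
  refine ⟨fun v => φ v 0, arc, ?_, ?_, ?_, ?_⟩
  · intro u v h
    have h' : φ u 0 = φ v 0 := h
    exact hCd (h0C u) (h' ▸ h0C v)
  · intro u v h
    exact (harc s(u, v) h).1 u v rfl
  · intro e he w hw
    exact hmem e he w _ hw (h0C w)
  · intro e he f hf hef
    rw [disjoint_left]
    rintro z ⟨hze, hzp⟩ hzf
    by_cases hC : ∃ w, z ∈ φ w '' closedBall 0 1
    · obtain ⟨w, hw⟩ := hC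
      have hwe := hmem e he w z hze hw
      have hwf := hmem f hf w z hzf hw
      obtain ⟨s, hs, hsK, hsA⟩ := (harc e he).2.2 w hwe
      obtain ⟨t, ht, htK, htA⟩ := (harc f hf).2.2 w hwf
      -- Inside a disc both arcs run along radii. A common point other than the centre would force
      -- equal radii, but their outer ends lie in the disjoint regions `K e` and `K f`.
      obtain ⟨a, ha, rfl⟩ := hsA ⟨hze, hw⟩
      obtain ⟨b, hb, hab⟩ := htA ⟨hzf, hw⟩
      obtain rfl := (φ w).injective hab
      rw [segment_eq_image] at ha hb
      obtain ⟨q, hq, rfl⟩ := ha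
      obtain ⟨r, hr, hqr⟩ := hb
      simp only [smul_zero, zero_add] at hqr hzp
      rw [mem_sphere_zero_iff_norm] at hs ht
      have hqr' : r = q := by
        have := congrArg norm hqr
        rwa [norm_smul, norm_smul, hs, ht, mul_one, mul_one, Real.norm_of_nonneg hq.1,
          Real.norm_of_nonneg hr.1] at this
      subst hqr'
      rcases eq_or_ne r 0 with rfl | hr0
      · exact hzp ⟨w, hwe, by simp⟩
      · have hts : t = s := smul_right_injective _ hr0 hqr
        subst hts
        exact disjoint_left.1 (hKd e he f hf hef) hsK htK
    · have h1 := ((harc e he).2.1 z hze).resolve_right fun ⟨v, _, h⟩ => hC ⟨v, h⟩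
      have h2 := ((harc f hf).2.1 z hzf).resolve_right fun ⟨v, _, h⟩ => hC ⟨v, h⟩
      exact disjoint_left.1 (hKd e he f hf hef) h1 h2

end Regions
-- Unicoherence by lifting circle-valued maps
section Unicoherence

open Set Metric Topology

/-- The values of `k` lie in `2πℤ`, while the image of `S` is order-connected: two different values
would make `k x + π` a value as well. -/
theorem IsPreconnected.eq_of_circleExp_eq_one {X : Type*} [TopologicalSpace X] {S : Set X}
    (hS : IsPreconnected S) {k : X → ℝ} (hk : ContinuousOn k S)
    (h : ∀ x ∈ S, Circle.exp (k x) = 1) {x y : X} (hx : x ∈ S) (hy : y ∈ S) : k x = k y := by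
  wlog hxy : k x ≤ k y generalizing x y
  · exact (this hy hx (le_of_not_ge hxy)).symm
  by_contra hne
  have hlt : k x < k y := lt_of_le_of_ne hxy hne
  obtain ⟨m, hm⟩ := Circle.exp_eq_one.1 (h x hx)
  obtain ⟨n, hn⟩ := Circle.exp_eq_one.1 (h y hy)
  have hpi := Real.pi_pos
  have hmn : (m : ℝ) + 1 ≤ n := by
    have : (m : ℝ) < n := by
      by_contra hc
      have : (n : ℝ) * (2 * Real.pi) ≤ m * (2 * Real.pi) := by
        gcongr
        exact_mod_cast not_lt.1 hc
      linarith
    exact_mod_cast this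
  have hmem : k x + Real.pi ∈ k '' S := by
    refine (hS.image k hk).ordConnected.out (mem_image_of_mem _ hx) (mem_image_of_mem _ hy) ⟨?_, ?_⟩
    · linarith
    · rw [hm, hn]
      nlinarith
  obtain ⟨z, hz, hzk⟩ := hmem
  obtain ⟨j, hj⟩ := Circle.exp_eq_one.1 (h z hz)
  have h2 : (2 * m + 1 : ℝ) = 2 * j := by
    have : Real.pi * (2 * m + 1 - 2 * j) = 0 := by linarith
    rcases mul_eq_zero.1 this with h | h
    · exact absurd h hpi.ne'
    · linarith
  have h3 : 2 * m + 1 = 2 * j := by exact_mod_cast h2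
  omega

/-- In a simply connected space, the union of two disjoint closed sets that do not separate the
space does not separate it either. -/
theorem isPreconnected_compl_union {X : Type*} [TopologicalSpace X] [NormalSpace X]
    [SimplyConnectedSpace X] [LocallyPathConnectedSpace X] {A B : Set X} (hA : IsClosed A)
    (hB : IsClosed B) (hAB : Disjoint A B) (hA' : IsPreconnected Aᶜ) (hB' : IsPreconnected Bᶜ) :
    IsPreconnected (A ∪ B)ᶜ := by
  classical
  rintro u v hu hv huv ⟨p, hp, hpu⟩ ⟨q, hq, hqv⟩
  by_contra hne
  have hS : IsOpen (A ∪ B)ᶜ := (hA.union hB).isOpen_compl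
  set P := (A ∪ B)ᶜ ∩ u with hPdef
  set Q := (A ∪ B)ᶜ ∩ v with hQdef
  have hP : IsOpen P := hS.inter hu
  have hQ : IsOpen Q := hS.inter hv
  have hPQ : Disjoint P Q := by
    rw [disjoint_left]
    exact fun x hx hx' => hne ⟨x, hx.1, hx.2, hx'.2⟩
  have hfr : frontier Q ⊆ A ∪ B := by
    intro x hx
    by_contra hxAB
    rw [hQ.frontier_eq] at hx
    rcases huv hxAB with h | h
    · exact disjoint_left.1 (hPQ.closure_right hP) ⟨hxAB, h⟩ hx.1
    · exact hx.2 ⟨hxAB, h⟩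
  obtain ⟨g, hgA, hgB, -⟩ := exists_continuous_zero_one_of_isClosed hA hB hAB
  -- If `P` and `Q` separate the complement, then `frontier Q` lies in `A ∪ B`, where `g` is 0 or 1
  -- and both branches equal 1. Simple connectedness then gives a real lift `h` of this map.
  have hfc : Continuous fun x => if x ∈ Q then (1 : Circle) else Circle.exp (2 * Real.pi * g x) := by
    refine Continuous.if ?_ continuous_const (by fun_prop)
    intro x hx
    rcases hfr hx with h | h
    · rw [hgA h]; simp
    · rw [hgB h]; simp
  let f : C(X, Circle) := ⟨_, hfc⟩
  obtain ⟨e₀, he₀⟩ := Circle.exp_surjective (f p)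
  obtain ⟨h, ⟨-, hh⟩, -⟩ := Circle.isCoveringMap_exp.existsUnique_continuousMap_lifts f p e₀ he₀
  have hhx : ∀ x, Circle.exp (h x) = f x := fun x => congrFun hh x
  have hfQ : ∀ x ∈ Q, f x = 1 := fun x hx => if_pos hx
  have hfQ' : ∀ x, x ∉ Q → f x = Circle.exp (2 * Real.pi * g x) := fun x hx => if_neg hx
  have hpQ : p ∉ Q := fun h => disjoint_left.1 hPQ ⟨hp, hpu⟩ h
  have hqQ : q ∈ Q := ⟨hq, hqv⟩
  -- The map equal to `h` on `Q` and to `h - 2π(g - d)` elsewhere is continuous on `S` with values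
  -- in `2πℤ`, hence constant there. Using `S = Bᶜ`, `d = 0` and `S = Aᶜ`, `d = 1` gives two values
  -- of `h q` differing by `2π`.
  have key : ∀ (d : ℤ) (S : Set X), IsPreconnected S →
      (∀ x ∈ S ∩ frontier Q, g x = d) → p ∈ S → q ∈ S →
      h q = h p - 2 * Real.pi * (g p - d) := by
    intro d S hSc hd hpS hqS
    let k : X → ℝ := Q.piecewise h fun x => h x - 2 * Real.pi * (g x - d)
    have hk : ContinuousOn k S := by
      refine ContinuousOn.piecewise ?_ h.continuous.continuousOn
        (Continuous.continuousOn (by fun_prop))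
      intro x hx
      rw [hd x hx]; simp
    have hk1 : ∀ x ∈ S, Circle.exp (k x) = 1 := by
      intro x _
      by_cases hxQ : x ∈ Q
      · rw [show k x = h x from piecewise_eq_of_mem _ _ _ hxQ, hhx, hfQ x hxQ]
      · rw [show k x = h x - 2 * Real.pi * (g x - d) from piecewise_eq_of_notMem _ _ _ hxQ,
          Circle.exp_sub, hhx, hfQ' x hxQ, mul_sub, Circle.exp_sub, Circle.exp_two_pi_mul_int]
        simp
    have := hSc.eq_of_circleExp_eq_one hk hk1 hqS hpS
    rwa [show k q = h q from piecewise_eq_of_mem _ _ _ hqQ,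
      show k p = h p - 2 * Real.pi * (g p - d) from piecewise_eq_of_notMem _ _ _ hpQ] at this
  have h1 := key 0 Bᶜ hB' (fun x hx => by
      simpa using hgA ((hfr hx.2).resolve_right hx.1)) (fun h => hp (Or.inr h))
      (fun h => hq (Or.inr h))
  have h2 := key 1 Aᶜ hA' (fun x hx => by
      simpa using hgB ((hfr hx.2).resolve_left hx.1)) (fun h => hp (Or.inl h))
      (fun h => hq (Or.inl h))
  have hpi := Real.pi_pos
  push_cast at h1 h2
  linarith

theorem isPreconnected_compl_biUnion {X ι : Type*} [TopologicalSpace X] [NormalSpace X]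
    [SimplyConnectedSpace X] [LocallyPathConnectedSpace X] {A : ι → Set X} (s : Finset ι)
    (hA : ∀ i ∈ s, IsClosed (A i)) (hd : (s : Set ι).PairwiseDisjoint A)
    (hA' : ∀ i ∈ s, IsPreconnected (A i)ᶜ) : IsPreconnected (⋃ i ∈ s, A i)ᶜ := by
  classical
  induction s using Finset.induction_on with
  | empty => simpa using isPreconnected_univ
  | insert a s ha ih =>
    rw [Finset.set_biUnion_insert]
    rw [Finset.coe_insert] at hd
    refine isPreconnected_compl_union (hA a (Finset.mem_insert_self _ _)) ?_ ?_
      (hA' a (Finset.mem_insert_self _ _)) ?_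
    · exact s.finite_toSet.isClosed_biUnion fun i hi => hA i (Finset.mem_insert_of_mem hi)
    · rw [disjoint_iUnion₂_right]
      intro i hi
      exact hd (mem_insert _ _) (mem_insert_of_mem _ hi) (by rintro rfl; exact ha hi)
    · exact ih (fun i hi => hA i (Finset.mem_insert_of_mem hi)) (hd.subset (subset_insert _ _))
        (fun i hi => hA' i (Finset.mem_insert_of_mem hi))

theorem isPreconnected_diff_biUnion {X ι : Type*} [TopologicalSpace X] {D : Set X} [NormalSpace D]
    [SimplyConnectedSpace D] [LocallyPathConnectedSpace D] {A : ι → Set X} (s : Finset ι)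
    (hA : ∀ i ∈ s, IsClosed (A i))
    (hd : ∀ i ∈ s, ∀ j ∈ s, i ≠ j → Disjoint (D ∩ A i) (D ∩ A j))
    (hA' : ∀ i ∈ s, IsPreconnected (D \ A i)) : IsPreconnected (D \ ⋃ i ∈ s, A i) := by
  have himg : ∀ B : Set X, D \ B = ((↑) : D → X) '' ((↑) ⁻¹' B)ᶜ := by
    intro B
    ext x
    simp
  rw [himg, IsInducing.subtypeVal.isPreconnected_image, preimage_iUnion₂]
  refine isPreconnected_compl_biUnion s (fun i hi => (hA i hi).preimage continuous_subtype_val)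
    ?_ ?_
  · intro i hi j hj hij
    change Disjoint _ _
    rw [disjoint_left]
    intro x hx hx'
    exact disjoint_left.1 (hd i hi j hj hij) ⟨x.2, hx⟩ ⟨x.2, hx'⟩
  · intro i hi
    rw [← IsInducing.subtypeVal.isPreconnected_image, ← himg]
    exact hA' i hi

end Unicoherence
-- Regions obtained from a simple representation
section Representation

open Set Metric Topology

theorem exists_injOn_mem {V α : Type*} [Finite V] {I : V → Set α} (s : Set V)
    (hI : ∀ v ∈ s, (I v).Infinite) (hne : ∀ v, (I v).Nonempty) :
    ∃ p : V → α, InjOn p s ∧ ∀ v, p v ∈ I v := by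
  classical
  induction s, s.toFinite using Set.Finite.induction_on with
  | empty =>
    choose p hp using hne
    exact ⟨p, injOn_empty _, hp⟩
  | @insert a s ha _ ih =>
    obtain ⟨p, hp, hpI⟩ := ih fun v hv => hI v (mem_insert_of_mem _ hv)
    obtain ⟨x, hx, hxp⟩ := (hI a (mem_insert _ _)).exists_notMem_finite (s.toFinite.image p)
    have heq : EqOn (Function.update p a x) p s := fun v hv =>
      Function.update_of_ne (by rintro rfl; exact ha hv) _ _
    refine ⟨Function.update p a x, (injOn_insert ha).2 ⟨hp.congr heq.symm, ?_⟩, ?_⟩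
    · rwa [Function.update_self, heq.image_eq]
    · intro v
      rcases eq_or_ne v a with rfl | h
      · rwa [Function.update_self]
      · rw [Function.update_of_ne h]; exact hpI v

theorem IsSimpleFamily.eq_of_mem {V : Type*} {c : V → Set Plane} (hc : IsSimpleFamily c)
    {u v w : V} {x : Plane} (huv : u ≠ v) (hu : x ∈ c u) (hv : x ∈ c v) (hw : x ∈ c w) :
    w = u ∨ w = v := by
  by_contra! h
  have h3 : ({u, v, w} : Set V).encard = 3 := by
    rw [encard_insert_of_notMem, encard_pair h.2.symm]
    · norm_num
    · simp [huv, h.1.symm]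
  have hle := (encard_le_encard (show {u, v, w} ⊆ {v | x ∈ c v} by
    simp [insert_subset_iff, hu, hv, hw])).trans (hc x)
  rw [h3] at hle
  exact absurd hle (by decide)

/-- A connected set that meets the component `K` of an open set `N`, and whose part in `N` lies in
a closed subset of `N`, is contained in `K`. -/
theorem subset_connectedComponentIn_of_inter_subset {X : Type*} [TopologicalSpace X]
    [LocallyConnectedSpace X] {N A D : Set X} (hN : IsOpen N) (hA : IsClosed A) (hAN : A ⊆ N)
    (hD : IsPreconnected D) {a : X} (haD : a ∈ D) (haN : a ∈ N)
    (h : connectedComponentIn N a ∩ D ⊆ A) : D ⊆ connectedComponentIn N a := by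
  set K := connectedComponentIn N a with hK
  have hKo : IsOpen K := hN.connectedComponentIn
  -- Limit points of `K ∩ D` stay in `A ⊆ N`, and adjoining one to the component keeps it connected.
  -- Hence `K ∩ D` is open and closed in `D`.
  have hcl : closure (K ∩ D) ⊆ K := by
    intro y hy
    have hyN : y ∈ N := hAN (closure_minimal h hA hy)
    have hyK : y ∈ closure K := closure_mono inter_subset_left hy
    have hpre : IsPreconnected (insert y K) := by
      refine isPreconnected_connectedComponentIn.subset_closure (subset_insert _ _) ?_
      exact insert_subset hyK subset_closure
    exact hpre.subset_connectedComponentIn (mem_insert_of_mem _ (mem_connectedComponentIn haN))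
      (insert_subset hyN (connectedComponentIn_subset _ _)) (mem_insert _ _)
  intro z hz
  by_contra hzK
  obtain ⟨w, hwD, hwK, hw⟩ := hD K (closure (K ∩ D))ᶜ hKo isClosed_closure.isOpen_compl
    (fun w _ => by
      by_cases hw : w ∈ K
      · exact Or.inl hw
      · exact Or.inr fun h => hw (hcl h))
    ⟨a, haD, mem_connectedComponentIn haN⟩ ⟨z, hz, fun h => hzK (hcl h)⟩
  exact hw (subset_closure ⟨hwK, hwD⟩)

/-- The union of all open balls with center in `R` whose radius is at most half of the distance of
the center to `D`. -/
def collar (R D : Set Plane) : Set Plane :=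
  {y | ∃ x ∈ R, ∃ ρ : ℝ, dist y x < ρ ∧ ∀ z ∈ D, 2 * ρ ≤ dist x z}

theorem isOpen_collar (R D : Set Plane) : IsOpen (collar R D) := by
  have : collar R D = ⋃ x ∈ R, ⋃ ρ ∈ {ρ : ℝ | ∀ z ∈ D, 2 * ρ ≤ dist x z}, ball x ρ := by
    ext y
    simp only [collar, mem_ofPred_eq, mem_iUnion, mem_ball, exists_prop]
    exact ⟨fun ⟨x, hx, ρ, h1, h2⟩ => ⟨x, hx, ρ, h2, h1⟩,
      fun ⟨x, hx, ρ, h2, h1⟩ => ⟨x, hx, ρ, h1, h2⟩⟩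
  rw [this]
  exact isOpen_biUnion fun x _ => isOpen_biUnion fun ρ _ => isOpen_ball

theorem subset_collar {R D : Set Plane} (hD : IsClosed D) (hRD : Disjoint R D) :
    R ⊆ collar R D := by
  intro x hx
  obtain ⟨r, hr, hrD⟩ := Metric.isOpen_iff.1 hD.isOpen_compl x (disjoint_left.1 hRD hx)
  refine ⟨x, hx, r / 2, by rw [dist_self]; positivity, fun z hz => ?_⟩
  by_contra hlt
  refine hrD (?_ : z ∈ ball x r) hz
  rw [mem_ball, dist_comm]
  linarith

theorem isConnected_collar {R D : Set Plane} (hR : IsConnected R) (hD : IsClosed D)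
    (hRD : Disjoint R D) : IsConnected (collar R D) := by
  have hsub := subset_collar hD hRD
  obtain ⟨x₀, hx₀⟩ := hR.nonempty
  refine ⟨⟨x₀, hsub hx₀⟩, isPreconnected_of_forall x₀ ?_⟩
  rintro y ⟨x, hx, ρ, hy, hρ⟩
  refine ⟨R ∪ ball x ρ, union_subset hsub fun w hw => ⟨x, hx, ρ, hw, hρ⟩, Or.inl hx₀, Or.inr hy,
    hR.isPreconnected.union x hx ?_ isPreconnected_ball⟩
  exact mem_ball_self (dist_nonneg.trans_lt hy)

/-- No point lies in three shapes, so compactness separates each pairwise intersection from each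
third shape. The factor 2 makes `ε`-neighbourhoods of intersections for different edges disjoint. -/
theorem exists_pos_forall_two_mul_le_dist {V : Type*} [Finite V] {c : V → Set Plane}
    (hs : IsSimpleFamily c) (hc : ∀ v, IsCompact (c v)) :
    ∃ ε : ℝ, 0 < ε ∧ ∀ u v w, u ≠ v → w ≠ u → w ≠ v → ∀ x ∈ c u ∩ c v, ∀ y ∈ c w,
      2 * ε ≤ dist x y := by
  have h : ∀ u v w, ∀ᶠ ε : ℝ in 𝓝[>] 0, u ≠ v → w ≠ u → w ≠ v → ∀ x ∈ c u ∩ c v, ∀ y ∈ c w,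
      2 * ε ≤ dist x y := by
    intro u v w
    by_cases hne : u ≠ v ∧ w ≠ u ∧ w ≠ v
    swap
    · exact Filter.Eventually.of_forall fun ε h1 h2 h3 => absurd ⟨h1, h2, h3⟩ hne
    have hdis : Disjoint (c u ∩ c v) (c w) := by
      rw [disjoint_left]
      rintro x ⟨hu, hv⟩ hw
      rcases hs.eq_of_mem hne.1 hu hv hw with h | h
      exacts [hne.2.1 h, hne.2.2 h]
    obtain ⟨δ, hδ, hd⟩ := hdis.exists_thickenings ((hc u).inter (hc v)) (hc w).isClosed
    filter_upwards [Ioo_mem_nhdsGT (show (0 : ℝ) < δ / 2 by positivity)] with ε hε _ _ _ x hx y hy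
    by_contra hlt
    refine disjoint_left.1 hd (?_ : y ∈ _) (self_subset_thickening hδ _ hy)
    rw [mem_thickening_iff]
    refine ⟨x, hx, ?_⟩
    rw [dist_comm]
    linarith [hε.2]
  have hall : ∀ᶠ ε : ℝ in 𝓝[>] 0, ∀ u v w, u ≠ v → w ≠ u → w ≠ v → ∀ x ∈ c u ∩ c v,
      ∀ y ∈ c w, 2 * ε ≤ dist x y := by
    rw [Filter.eventually_all]; intro u
    rw [Filter.eventually_all]; intro v
    rw [Filter.eventually_all]; intro w
    exact h u v w
  obtain ⟨ε, h1, h2⟩ := (hall.and self_mem_nhdsWithin).exists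
  exact ⟨ε, h2, h1⟩

/-- Meant for the shapes contained in other shapes. Some of them may coincide, so distinct centres
have to be chosen before the radius is shrunk. -/
theorem exists_disjoint_balls {V : Type*} [Finite V] {I : V → Set Plane} {s : Set V}
    (hI : ∀ v ∈ s, IsOpen (I v)) (hne : ∀ v ∈ s, (I v).Nonempty) :
    ∃ B : V → Set Plane, ∀ v ∈ s, IsOpen (B v) ∧ IsConnected (B v) ∧ B v ⊆ I v ∧
      ∀ u ∈ s, u ≠ v → Disjoint (B u) (B v) := by
  have : Infinite Plane := infinite_univ_iff.1
    (infinite_of_mem_nhds (0 : Plane) Filter.univ_mem)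
  obtain ⟨p, hp, hpI⟩ := exists_injOn_mem (I := fun v => {x : Plane | v ∈ s → x ∈ I v}) s
    (fun v hv => by
      have : {x : Plane | v ∈ s → x ∈ I v} = I v := by ext; simp [hv]
      rw [this]
      obtain ⟨x, hx⟩ := hne v hv
      exact infinite_of_mem_nhds x ((hI v hv).mem_nhds hx))
    (fun v => by
      by_cases hv : v ∈ s
      · obtain ⟨x, hx⟩ := hne v hv
        exact ⟨x, fun _ => hx⟩
      · exact ⟨0, fun h => absurd h hv⟩)
  have h1 : ∀ᶠ r : ℝ in 𝓝[>] 0, ∀ v, v ∈ s → ball (p v) r ⊆ I v := by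
    rw [Filter.eventually_all]
    intro v
    by_cases hv : v ∈ s
    swap
    · exact Filter.Eventually.of_forall fun r h => absurd h hv
    obtain ⟨δ, hδ, hb⟩ := Metric.isOpen_iff.1 (hI v hv) (p v) (hpI v hv)
    filter_upwards [Ioo_mem_nhdsGT hδ] with r hr _
    exact (ball_subset_ball hr.2.le).trans hb
  have h2 : ∀ᶠ r : ℝ in 𝓝[>] 0, ∀ u v, u ∈ s → v ∈ s → u ≠ v → 2 * r < dist (p u) (p v) := by
    rw [Filter.eventually_all]; intro u
    rw [Filter.eventually_all]; intro v
    by_cases h : u ∈ s ∧ v ∈ s ∧ u ≠ v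
    swap
    · exact Filter.Eventually.of_forall fun r a b c => absurd ⟨a, b, c⟩ h
    have hpos : 0 < dist (p u) (p v) := dist_pos.2 fun he => h.2.2 (hp h.1 h.2.1 he)
    filter_upwards [Ioo_mem_nhdsGT (half_pos hpos)] with r hr _ _ _
    linarith [hr.2]
  obtain ⟨r, ⟨hr1, hr2⟩, hr⟩ := ((h1.and h2).and self_mem_nhdsWithin).exists
  refine ⟨fun v => ball (p v) r, fun v hv => ⟨isOpen_ball, isConnected_ball hr, hr1 v hv, ?_⟩⟩
  intro u hu huv
  exact ball_disjoint_ball (by linarith [hr2 u v hu hv huv])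

theorem isPlanar_of_isIntersectionRepresentation {V : Type*} [Finite V] {G : SimpleGraph V}
    {c : V → Set Plane} (hG : IsIntersectionRepresentation G c) (hs : IsSimpleFamily c)
    (hc : ∀ v, IsCompact (c v)) (hcc : ∀ v, IsConnected (c v))
    (hR : ∀ v, IsPreconnected (c v \ ⋃ w ∈ {w | w ≠ v}, c w))
    (hint : ∀ u v, u ≠ v → c u ⊆ c v → (interior (c u)).Nonempty) : IsPlanar G := by
  classical
  obtain ⟨ε, hε, hεd⟩ := exists_pos_forall_two_mul_le_dist hs hc
  let D : V → Set Plane := fun v => ⋃ w ∈ {w | w ≠ v}, c w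
  have hDmem : ∀ {u v x}, u ≠ v → x ∈ c u → x ∈ D v := fun {u v x} huv hx =>
    mem_biUnion (show u ∈ {w | w ≠ v} from huv) hx
  have hDc : ∀ v, IsClosed (D v) := fun v =>
    (toFinite _).isClosed_biUnion fun w _ => (hc w).isClosed
  let A : Sym2 V → Set Plane := fun e => {x | ∀ v ∈ e, x ∈ c v}
  have hAmk : ∀ u v, A s(u, v) = c u ∩ c v := fun u v => by
    ext x
    simp [A]
  have hA : ∀ e ∈ G.edgeSet, ∃ x, x ∈ A e := by
    intro e he
    induction e using Sym2.ind with
    | _ u v =>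
    rw [hAmk]
    exact ((hG u v).1 he).2
  have hAc : ∀ e ∈ G.edgeSet, IsClosed (A e) := by
    intro e he
    induction e using Sym2.ind with
    | _ u v =>
    rw [hAmk]
    exact (hc u).isClosed.inter (hc v).isClosed
  have hAd : ∀ e ∈ G.edgeSet, ∀ w, w ∉ e → ∀ x ∈ A e, ∀ y ∈ c w, 2 * ε ≤ dist x y := by
    intro e he w hw x hx y hy
    induction e using Sym2.ind with
    | _ u v =>
    rw [hAmk] at hx
    rw [Sym2.mem_iff, not_or] at hw
    exact hεd u v w (G.ne_of_adj he) hw.1 hw.2 x hx y hy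
  have hN : ∀ e, ∀ y ∈ thickening ε (A e), ∃ x ∈ A e, dist y x < ε := fun e y hy =>
    (mem_thickening_iff).1 hy
  have hNd : ∀ e ∈ G.edgeSet, ∀ w, w ∉ e → Disjoint (thickening ε (A e)) (c w) := by
    intro e he w hw
    rw [disjoint_left]
    intro y hy hyw
    obtain ⟨x, hx, hxy⟩ := hN e y hy
    have := hAd e he w hw x hx y hyw
    rw [dist_comm] at this
    linarith
  have ha : ∀ e, ∃ a, e ∈ G.edgeSet → a ∈ A e := fun e => by
    by_cases he : e ∈ G.edgeSet
    · obtain ⟨a, ha⟩ := hA e he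
      exact ⟨a, fun _ => ha⟩
    · exact ⟨0, fun h => absurd h he⟩
  choose a ha using ha
  let K : Sym2 V → Set Plane := fun e => connectedComponentIn (thickening ε (A e)) (a e)
  have haN : ∀ e ∈ G.edgeSet, a e ∈ thickening ε (A e) := fun e he =>
    self_subset_thickening hε _ (ha e he)
  have hKN : ∀ e, K e ⊆ thickening ε (A e) := fun e => connectedComponentIn_subset _ _
  let S : Set V := {v | ∃ u, u ≠ v ∧ c v ⊆ c u}
  obtain ⟨B, hB⟩ := exists_disjoint_balls (I := fun v => interior (c v)) (s := S)
    (fun v _ => isOpen_interior) (fun v ⟨u, huv, hvu⟩ => hint v u huv.symm hvu)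
  have hBc : ∀ v ∈ S, B v ⊆ c v := fun v hv => (hB v hv).2.2.1.trans interior_subset
  have hRD : ∀ v, Disjoint (c v \ D v) (D v) := fun v => disjoint_sdiff_left
  -- for a shape not contained in another one, the region of an edge leaves the other shape
  have hKR : ∀ e ∈ G.edgeSet, ∀ w ∈ e, w ∉ S → (K e ∩ (c w \ D w)).Nonempty := by
    intro e he w hw hwS
    obtain ⟨v, rfl⟩ := hw
    have hwv : w ≠ v := G.ne_of_adj he
    -- Otherwise the connected set `c w` would stay inside `K`, hence inside `A`, and so be
    -- contained in `c v`. A point of `K ∩ c w` outside `c v` is private, since the neighbourhood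
    -- avoids every third shape.
    have : ¬ K s(w, v) ∩ c w ⊆ A s(w, v) := by
      intro hsub
      have h1 := subset_connectedComponentIn_of_inter_subset
        isOpen_thickening (hAc _ he) (self_subset_thickening hε _) (hcc w).isPreconnected
        (by have := ha _ he; rw [hAmk] at this; exact this.1) (haN _ he) hsub
      refine hwS ⟨v, hwv.symm, fun x hx => ?_⟩
      have := hsub ⟨h1 hx, hx⟩
      rw [hAmk] at this
      exact this.2
    obtain ⟨z, ⟨hzK, hzw⟩, hzA⟩ := not_subset.1 this
    refine ⟨z, hzK, hzw, ?_⟩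
    intro hzD
    obtain ⟨u, hu, hzu⟩ := mem_iUnion₂.1 hzD
    rw [hAmk] at hzA
    by_cases hue : u ∈ s(w, v)
    · rcases Sym2.mem_iff.1 hue with rfl | rfl
      · exact hu rfl
      · exact hzA ⟨hzw, hzu⟩
    · exact disjoint_left.1 (hNd _ he u hue) (hKN _ hzK) hzu
  have hRc : ∀ v, v ∉ S → IsConnected (c v \ D v) := by
    intro v hv
    refine ⟨?_, hR v⟩
    by_cases h : ∃ u, G.Adj v u
    · obtain ⟨u, hu⟩ := h
      obtain ⟨z, -, hz⟩ := hKR s(v, u) hu v (Sym2.mem_mk_left v u) hv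
      exact ⟨z, hz⟩
    · obtain ⟨x, hx⟩ := (hcc v).nonempty
      refine ⟨x, hx, fun hxD => ?_⟩
      obtain ⟨u, hu, hxu⟩ := mem_iUnion₂.1 hxD
      exact h ⟨u, (hG v u).2 ⟨Ne.symm hu, x, hx, hxu⟩⟩
  have hcol : ∀ u v, u ≠ v → Disjoint (collar (c v \ D v) (D v)) (c u) := by
    intro u v huv
    rw [disjoint_left]
    rintro y ⟨x, hx, ρ, hyx, hρ⟩ hy
    have := hρ y (hDmem huv hy)
    rw [dist_comm] at this
    linarith [dist_nonneg (x := y) (y := x)]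
  let O : V → Set Plane := fun v => if v ∈ S then B v else collar (c v \ D v) (D v)
  have hO1 : ∀ v ∈ S, O v = B v := fun v hv => if_pos hv
  have hO2 : ∀ v, v ∉ S → O v = collar (c v \ D v) (D v) := fun v hv => if_neg hv
  refine isPlanar_of_regions (O := O) (K := K) ?_ ?_ ?_ ?_ ?_ ?_ ?_ ?_
  · intro v
    by_cases hv : v ∈ S
    · rw [hO1 v hv]; exact (hB v hv).1
    · rw [hO2 v hv]; exact isOpen_collar _ _
  · intro v
    by_cases hv : v ∈ S
    · rw [hO1 v hv]; exact (hB v hv).2.1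
    · rw [hO2 v hv]; exact isConnected_collar (hRc v hv) (hDc v) (hRD v)
  · intro u v huv
    by_cases hu : u ∈ S <;> by_cases hv : v ∈ S
    · rw [hO1 u hu, hO1 v hv]; exact (hB v hv).2.2.2 u hu huv
    · rw [hO1 u hu, hO2 v hv]; exact (hcol u v huv).symm.mono_left (hBc u hu)
    · rw [hO2 u hu, hO1 v hv]; exact (hcol v u huv.symm).mono_right (hBc v hv)
    · rw [hO2 u hu, hO2 v hv, disjoint_left]
      -- Each centre lies in a shape the other has to avoid, so `2ρ` and `2ρ'` are at most `dist x
      -- x' < ρ + ρ'`.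
      rintro y ⟨x, hx, ρ, hyx, hρ⟩ ⟨x', hx', ρ', hyx', hρ'⟩
      have h1 := hρ x' (hDmem huv.symm hx'.1)
      have h2 := hρ' x (hDmem huv hx.1)
      have h3 := dist_triangle_left x x' y
      rw [dist_comm] at h2
      linarith
  · exact fun e _ => isOpen_thickening.connectedComponentIn
  · exact fun e he => isConnected_connectedComponentIn_iff.2 (haN e he)
  · intro e he f hf hef
    have hw : ∃ w ∈ f, w ∉ e := by
      by_contra! hsub
      refine hef ?_
      induction f using Sym2.ind with
      | _ u v =>
      exact ((Sym2.mem_and_mem_iff (G.ne_of_adj hf)).1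
        ⟨hsub u (Sym2.mem_mk_left u v), hsub v (Sym2.mem_mk_right u v)⟩)
    obtain ⟨w, hwf, hwe⟩ := hw
    rw [disjoint_left]
    intro y hye hyf
    obtain ⟨x, hx, hyx⟩ := hN e y (hKN e hye)
    obtain ⟨x', hx', hyx'⟩ := hN f y (hKN f hyf)
    have h1 := hAd e he w hwe x hx x' (hx' w hwf)
    have h2 := dist_triangle_left x x' y
    linarith
  · intro e he w hw
    by_cases hwS : w ∈ S
    · rw [hO1 w hwS]
      obtain ⟨u, huw, hwu⟩ := hwS
      obtain ⟨v, rfl⟩ := hw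
      have hwv : w ≠ v := G.ne_of_adj he
      have haw := ha _ he
      rw [hAmk] at haw
      -- A point of `c w ∩ c v` also lies in `c u`, so simplicity leaves `v = u` as the only
      -- neighbour. Then `c w` is the whole intersection and lies in the edge region.
      have hvu : v = u :=
        (hs.eq_of_mem huw.symm haw.1 (hwu haw.1) haw.2).resolve_left hwv.symm
      subst hvu
      have hsub : c w ⊆ K s(w, v) := by
        refine (hcc w).isPreconnected.subset_connectedComponentIn haw.1 ?_
        refine Subset.trans ?_ (self_subset_thickening hε _)
        rw [hAmk]
        exact fun x hx => ⟨hx, hwu hx⟩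
      obtain ⟨x, hx⟩ := (hB w ⟨v, huw, hwu⟩).2.1.nonempty
      exact ⟨x, hsub (hBc w ⟨v, huw, hwu⟩ hx), hx⟩
    · rw [hO2 w hwS]
      exact (hKR e he w hw hwS).mono (inter_subset_inter_right _ (subset_collar (hDc w) (hRD w)))
  · intro e he w hw
    by_cases hwS : w ∈ S
    · rw [hO1 w hwS]
      exact (hNd e he w hw).mono (hKN e) (hBc w hwS)
    · rw [hO2 w hwS, disjoint_left]
      rintro y hy ⟨x, hx, ρ, hyx, hρ⟩
      obtain ⟨x', hx', hyx'⟩ := hN e y (hKN e hy)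
      have h1 := hAd e he w hw x' hx' x hx.1
      -- `x'` belongs to the shape of an end of `e`, which is not `w`; hence `x'` is in `D w`.
      have h2 : 2 * ρ ≤ dist x x' := by
        induction e using Sym2.ind with
        | _ u v =>
        refine hρ x' (hDmem (u := u) ?_ (hx' u (Sym2.mem_mk_left u v)))
        rintro rfl
        exact hw (Sym2.mem_mk_left _ _)
      have h3 := dist_triangle_left x x' y
      rw [dist_comm] at h1
      linarith

/-- A point common to two traces on `c v` would lie in three shapes; the traces are therefore
disjoint and unicoherence applies. -/
theorem isPreconnected_diff_biUnion_ne {V : Type*} [Finite V] {c : V → Set Plane}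
    (hs : IsSimpleFamily c) (hc : ∀ v, IsCompact (c v)) (v : V) [SimplyConnectedSpace (c v)]
    [LocallyPathConnectedSpace (c v)] (h : ∀ w, v ≠ w → IsPreconnected (c v \ c w)) :
    IsPreconnected (c v \ ⋃ w ∈ {w | w ≠ v}, c w) := by
  have := isPreconnected_diff_biUnion (D := c v) (A := c) (toFinite {w | w ≠ v}).toFinset
    (fun w _ => (hc w).isClosed) ?_ (fun w hw => h w ?_)
  · simpa using this
  · intro i hi j hj hij
    rw [disjoint_left]
    rintro x ⟨hxv, hxi⟩ ⟨-, hxj⟩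
    rw [Finite.mem_toFinset] at hi hj
    rcases hs.eq_of_mem hij hxi hxj hxv with h | h
    exacts [hi h.symm, hj h.symm]
  · rw [Finite.mem_toFinset] at hw
    exact Ne.symm hw

theorem isPlanar_of_isDisk {V : Type*} [Finite V] {G : SimpleGraph V} {c : V → Set Plane}
    (hG : IsIntersectionRepresentation G c) (hs : IsSimpleFamily c) (hd : ∀ v, IsDisk (c v))
    (h : ∀ u v, u ≠ v → IsConnected (c u \ c v)) : IsPlanar G := by
  have hball := (convex_closedBall (0 : Plane) 1).locallyPathConnectedSpace
  have hcontr := (convex_closedBall (0 : Plane) 1).contractibleSpace ⟨0, by simp⟩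
  have hcomp : CompactSpace (closedBall (0 : Plane) 1) :=
    isCompact_iff_compactSpace.1 (isCompact_closedBall 0 1)
  have hc : ∀ v, IsCompact (c v) := fun v => by
    obtain ⟨φ⟩ := hd v
    exact isCompact_iff_compactSpace.2 φ.symm.compactSpace
  have hcontr' : ∀ v, ContractibleSpace (c v) := fun v => by
    obtain ⟨φ⟩ := hd v
    exact φ.contractibleSpace
  have hloc : ∀ v, LocallyPathConnectedSpace (c v) := fun v => by
    obtain ⟨φ⟩ := hd v
    exact φ.symm.isQuotientMap.locallyPathConnectedSpace
  refine isPlanar_of_isIntersectionRepresentation hG hs hc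
    (fun v => isConnected_iff_connectedSpace.2 inferInstance)
    (fun v => isPreconnected_diff_biUnion_ne hs hc v fun w hvw => (h v w hvw).isPreconnected) ?_
  intro u v huv hsub
  exact absurd (h u v huv).nonempty (by rw [sdiff_eq_empty.2 hsub]; exact not_nonempty_empty)

end Representation
-- Homothetic triangles in barycentric coordinates
section Triangles

open Set Metric Topology

/-- The affine basis of the plane formed by the vertices of a triangle. -/
noncomputable def triangleBasis (Δ : Affine.Triangle ℝ Plane) : AffineBasis (Fin 3) ℝ Plane :=
  ⟨Δ.points, Δ.independent, Δ.span_eq_top (by simp)⟩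

theorem fullTriangle_eq (Δ : Affine.Triangle ℝ Plane) :
    fullTriangle Δ = {x | ∀ i, 0 ≤ (triangleBasis Δ).coord i x} :=
  (triangleBasis Δ).convexHull_eq_nonneg_coord

theorem AffineBasis.coord_smul_add {ι : Type*} (b : AffineBasis ι ℝ Plane) (i : ι) (h : ℝ)
    (x a : Plane) :
    b.coord i (h • x + a) = h * b.coord i x + (b.coord i a - h * b.coord i 0) := by
  have h1 : ∀ y z : Plane, b.coord i (y + z) = (b.coord i).linear y + b.coord i z := fun y z =>
    (b.coord i).map_vadd z y
  have h2 : b.coord i x = (b.coord i).linear x + b.coord i 0 := by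
    simpa using h1 x 0
  rw [h1, h2, map_smul, smul_eq_mul]
  ring

/-- A homothet of a triangle in terms of barycentric coordinates. -/
theorem IsHomothet.exists_coord {Δ : Affine.Triangle ℝ Plane} {T : Set Plane}
    (hT : IsHomothet (fullTriangle Δ) T) :
    ∃ τ : Fin 3 → ℝ, T = {y | ∀ i, τ i ≤ (triangleBasis Δ).coord i y} ∧
      ∀ k, ∃ q ∈ T, ∀ i, i ≠ k → (triangleBasis Δ).coord i q = τ i := by
  obtain ⟨h, a, hh, rfl⟩ := hT
  set b := triangleBasis Δ
  refine ⟨fun i => b.coord i a - h * b.coord i 0, ?_, fun k => ⟨h • b k + a, ⟨b k, ?_, rfl⟩, ?_⟩⟩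
  · ext y
    rw [fullTriangle_eq]
    constructor
    · rintro ⟨x, hx, rfl⟩ i
      change _ ≤ b.coord i (h • x + a)
      rw [b.coord_smul_add]
      have := mul_nonneg hh.le (hx i)
      linarith
    · intro hy
      have hyx : h • (h⁻¹ • (y - a)) + a = y := by
        rw [smul_inv_smul₀ hh.ne', sub_add_cancel]
      refine ⟨h⁻¹ • (y - a), fun i => ?_, hyx⟩
      have h1 := hy i
      change _ ≤ b.coord i y at h1
      rw [← hyx, b.coord_smul_add] at h1
      exact nonneg_of_mul_nonneg_right (by linarith) hh
  · exact subset_convexHull ℝ _ (mem_range_self k)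
  · intro i hik
    rw [b.coord_smul_add, b.coord_apply_ne hik, mul_zero, zero_add]

/-- `T \ T'` is the union of three convex pieces `C i`, each cut from `T` by violating one
inequality of `T'`. On `T` the `i`-th coordinate is minimal at every vertex `k ≠ i`, so a non-empty
`C i` contains these vertices. Non-empty pieces `C i` and `C j` thus share a vertex `k` different
from `i` and `j`. -/
theorem IsHomothet.isPreconnected_diff {Δ : Affine.Triangle ℝ Plane} {T T' : Set Plane}
    (hT : IsHomothet (fullTriangle Δ) T) (hT' : IsHomothet (fullTriangle Δ) T') :
    IsPreconnected (T \ T') := by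
  obtain ⟨τ, hTτ, hq⟩ := hT.exists_coord
  obtain ⟨τ', hTτ', -⟩ := hT'.exists_coord
  set b := triangleBasis Δ
  have hT : ∀ y, y ∈ T ↔ ∀ i, τ i ≤ b.coord i y := fun y => by rw [hTτ]; rfl
  have hT' : ∀ y, y ∈ T' ↔ ∀ i, τ' i ≤ b.coord i y := fun y => by rw [hTτ']; rfl
  let C : Fin 3 → Set Plane := fun i => {y | y ∈ T ∧ b.coord i y < τ' i}
  have hC : ∀ i, C i ⊆ T \ T' := fun i y hy =>
    ⟨hy.1, fun h => absurd ((hT' y).1 h i) (not_le.2 hy.2)⟩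
  have hTc : Convex ℝ T := by
    rw [hTτ, ofPred_forall]
    exact convex_iInter fun i => (convex_Ici (τ i)).affine_preimage (b.coord i)
  have hCc : ∀ i, IsPreconnected (C i) := fun i =>
    (hTc.inter ((convex_Iio (τ' i)).affine_preimage (b.coord i))).isPreconnected
  have hex : ∀ x ∈ T \ T', ∃ i, x ∈ C i := by
    rintro x ⟨hx, hx'⟩
    rw [hT'] at hx'
    push Not at hx'
    obtain ⟨i, hi⟩ := hx'
    exact ⟨i, hx, hi⟩
  refine isPreconnected_of_forall_pair fun x hx y hy => ?_
  obtain ⟨i, hi⟩ := hex x hx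
  obtain ⟨j, hj⟩ := hex y hy
  obtain ⟨k, hik, hjk⟩ := (by decide : ∀ i j : Fin 3, ∃ k, i ≠ k ∧ j ≠ k) i j
  obtain ⟨q, hqT, hqτ⟩ := hq k
  have hqi : q ∈ C i := ⟨hqT, by rw [hqτ i hik]; exact ((hT x).1 hi.1 i).trans_lt hi.2⟩
  have hqj : q ∈ C j := ⟨hqT, by rw [hqτ j hjk]; exact ((hT y).1 hj.1 j).trans_lt hj.2⟩
  exact ⟨C i ∪ C j, union_subset (hC i) (hC j), Or.inl hi, Or.inr hj,
    (hCc i).union q hqi hqj (hCc j)⟩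

/-- One triangle may contain another, so differences can be empty; the non-empty interiors then
provide the balls for the contained triangles. -/
theorem isPlanar_of_isHomothet {V : Type*} [Finite V] {G : SimpleGraph V}
    {Δ : Affine.Triangle ℝ Plane} {c : V → Set Plane}
    (hG : IsIntersectionRepresentation G c) (hs : IsSimpleFamily c)
    (hh : ∀ v, IsHomothet (fullTriangle Δ) (c v)) : IsPlanar G := by
  have hcont : ∀ (h : ℝ) (a : Plane), Continuous fun x : Plane => h • x + a := fun h a => by
    fun_prop
  have hc : ∀ v, IsCompact (c v) := fun v => by
    obtain ⟨h, a, -, hv⟩ := hh v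
    rw [hv]
    exact ((finite_range Δ.points).isCompact_convexHull (𝕜 := ℝ)).image (hcont h a)
  have hne : ∀ v, (c v).Nonempty := fun v => by
    obtain ⟨τ, -, hq⟩ := (hh v).exists_coord
    obtain ⟨q, hq, -⟩ := hq 0
    exact ⟨q, hq⟩
  have hconv : ∀ v, Convex ℝ (c v) := fun v => by
    obtain ⟨h, a, -, hv⟩ := hh v
    rw [hv]
    simp_rw [add_comm _ a]
    exact Convex.affinity (convex_convexHull ℝ (range Δ.points)) a h
  have hint : ∀ v, (interior (c v)).Nonempty := fun v => by
    obtain ⟨h, a, h0, hv⟩ := hh v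
    have hopen : IsOpenMap fun x : Plane => h • x + a :=
      (Homeomorph.addRight a).isOpenMap.comp (Homeomorph.smulOfNeZero h h0.ne').isOpenMap
    have hT : (interior (fullTriangle Δ)).Nonempty :=
      interior_convexHull_nonempty_iff_affineSpan_eq_top.2 (Δ.span_eq_top (by simp))
    rw [hv]
    exact (hT.image _).mono (hopen.image_interior_subset _)
  have hcontr : ∀ v, ContractibleSpace (c v) := fun v => (hconv v).contractibleSpace (hne v)
  have hloc : ∀ v, LocallyPathConnectedSpace (c v) := fun v => (hconv v).locallyPathConnectedSpace
  exact isPlanar_of_isIntersectionRepresentation hG hs hc (fun v => (hconv v).isConnected (hne v))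
    (fun v => isPreconnected_diff_biUnion_ne hs hc v fun w _ => (hh v).isPreconnected_diff (hh w))
    (fun u _ _ _ => hint u)

end Triangles

theorem lemma1 {V : Type*} [Finite V] (G : SimpleGraph V) :
    (∀ c : V → Set Plane,
      IsIntersectionRepresentation G c → IsSimpleFamily c → (∀ v : V, IsDisk (c v)) →
      (∀ u v : V, u ≠ v → IsConnected (c u \ c v)) →
      IsPlanar G) ∧
    (∀ (Δ : Affine.Triangle ℝ Plane) (T T' : Set Plane),
      IsHomothet (fullTriangle Δ) T → IsHomothet (fullTriangle Δ) T' →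
      IsPreconnected (T \ T')) ∧
    (∀ (Δ : Affine.Triangle ℝ Plane) (c : V → Set Plane),
      IsIntersectionRepresentation G c → IsSimpleFamily c →
      (∀ v : V, IsHomothet (fullTriangle Δ) (c v)) →
      IsPlanar G) :=
  ⟨fun _ hG hs hd h => isPlanar_of_isDisk hG hs hd h,
    fun _ _ _ hT hT' => hT.isPreconnected_diff hT',
    fun _ _ hG hs hh => isPlanar_of_isHomothet hG hs hh⟩
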